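/- Let $\Omega\subset\mathbb R^d$ be a bounded open set with closure $\overline\Omega$, let $\tau>0$, and let $C(\overline\Omega)$ be the space of continuous real functions on $\overline\Omega$ with the supremum norm. For $\phi,\psi\in C(\overline\Omega)$ put $$\phi^{c}(x)=\inf_{y\in\overline\Omega}\Big(\phi(y)+\tfrac1{2\tau}|x-y|^2\Big),\qquad \psi^{\bar c}(y)=\sup_{x\in\overline\Omega}\Big(\psi(x)-\tfrac1{2\tau}|x-y|^2\Big);$$ $\phi$ is called $c$-convex if $\phi^{c\bar c}=\phi$, and $\psi$ is called $c$-concave if $\psi^{\bar c c}=\psi$. Let $T_\phi(x)\in\operatorname{argmin}_{y\in\overline\Omega}\big(\phi(y)+\tfrac1{2\tau}|x-y|^2\big)$ and $S_\psi(y)\in\operatorname{argmax}_{x\in\overline\Omega}\big(\psi(x)-\tfrac1{2\tau}|x-y|^2\big)$. Let $U\colon L^1(\Omega)\to\mathbb R\cup\{+\infty\}$ be proper, convex and lower semicontinuous, with $U(\rho)=+\infty$ whenever $\rho$ is negative on a set of positive measure, and let $U^*(\phi)=\sup_{\rho\in L^1(\Omega)}\big(\int_\Omega\phi\rho\,dx-U(\rho)\big)$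 for $\phi\in L^\infty(\Omega)$. A functional $F$ on a normed space $V$ with values in $[-\infty,+\infty]$ has first variation $\delta F(v)$ at $v$ if $\delta F(v)$ is a bounded linear functional on $V$ such that, for every $h\in V$, $t\mapsto F(v+th)$ is finite near $t=0$ and has derivative $\delta F(v)(h)$ at $t=0$; densities and finite measures act on functions by integration. Fix a nonnegative $\mu\in L^1(\Omega)$. Then the functionals on $C(\overline\Omega)$ $$J(\phi)=\int_\Omega\phi^{c}\mu\,dx-U^*(\phi),\qquad I(\psi)=\int_\Omega\psi\mu\,dx-U^*(\psi^{\bar c})$$ are proper (never $+\infty$, and not identically $-\infty$), weakly upper semicontinuous and concave, and $$\sup_{\phi\in C(\overline\Omega)}J(\phi)=\sup_{\psi\in C(\overline\Omega)}I(\psi)\in[-\infty,+\infty].$$ If $\phi$ is $c$-convex, then the minimizer defining $T_\phi(x)$ is unique for almost every $x\in\Omega$, $T_\phi$ is measurable up to a null set, and, whenever $U^*$ has a first variation $\delta U^*(\phi)\in L^1(\Omega)$ at $\phi$ on $L^\infty(\Omega)$, $J$ has at $\phi$ the first variation $$\delta J(\phi)=T_{\phi\,\#}\mu-\delta U^*(\phi).$$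 If $\psi$ is $c$-concave, then the maximizer defining $S_\psi(y)$ is unique for almost every $y\in\Omega$, $S_\psi$ is measurable up to a null set, and, whenever $U^*$ has a first variation $\delta U^*(\psi^{\bar c})\in L^1(\Omega)$ at $\psi^{\bar c}$ on $L^\infty(\Omega)$, this density is nonnegative and $I$ has at $\psi$ the first variation $$\delta I(\psi)=\mu-S_{\psi\,\#}\,\delta U^*(\psi^{\bar c}).$$ -/

import Mathlib

open MeasureTheory Topology Filter

noncomputable section

/-! ### `c`-transforms on a compact metric space, for the cost `|x - y|² / (2τ)` -/

section Transforms

variable {X : Type*} [MetricSpace X]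

/-- The quadratic cost `|x - y|² / (2τ)`. -/
def quadCost (τ : ℝ) (x y : X) : ℝ := dist x y ^ 2 / (2 * τ)

theorem continuous_quadCost (τ : ℝ) : Continuous fun p : X × X => quadCost τ p.1 p.2 := by
  unfold quadCost
  fun_prop

variable [CompactSpace X]

/-- Backward transform `φᶜ(x) = inf_y φ(y) + |x - y|² / (2τ)`. -/
def backwardTransform (τ : ℝ) (φ : C(X, ℝ)) : C(X, ℝ) where
  toFun x := ⨅ y, (φ y + quadCost τ x y)
  continuous_toFun := by
    have h : Continuous (fun p : X × X => φ p.2 + quadCost τ p.1 p.2) :=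
      (φ.continuous.comp continuous_snd).add (continuous_quadCost τ)
    have h2 := IsCompact.continuous_sInf (f := fun x y => φ y + quadCost τ x y)
      (isCompact_univ (X := X)) h
    simpa [Set.image_univ, iInf] using h2

/-- Forward transform `ψ^c̄(y) = sup_x ψ(x) - |x - y|² / (2τ)`. -/
def forwardTransform (τ : ℝ) (ψ : C(X, ℝ)) : C(X, ℝ) where
  toFun y := ⨆ x, (ψ x - quadCost τ x y)
  continuous_toFun := by
    have h : Continuous (fun p : X × X => ψ p.2 - quadCost τ p.2 p.1) :=
      (ψ.continuous.comp continuous_snd).sub ((continuous_quadCost τ).comp continuous_swap)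
    have h2 := IsCompact.continuous_sSup (f := fun y x => ψ x - quadCost τ x y)
      (isCompact_univ (X := X)) h
    simpa [Set.image_univ, iSup] using h2

/-- `φ` is `c`-convex: `φ^{c c̄} = φ`. -/
def IsCConvex (τ : ℝ) (φ : C(X, ℝ)) : Prop :=
  forwardTransform τ (backwardTransform τ φ) = φ

/-- `ψ` is `c`-concave: `ψ^{c̄ c} = ψ`. -/
def IsCConcave (τ : ℝ) (ψ : C(X, ℝ)) : Prop :=
  backwardTransform τ (forwardTransform τ ψ) = ψ

/-- `argmin_y φ(y) + |x - y|² / (2τ)`, as a set. -/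
def argminSet (τ : ℝ) (φ : C(X, ℝ)) (x : X) : Set X :=
  {y | ∀ z, φ y + quadCost τ x y ≤ φ z + quadCost τ x z}

/-- `argmax_x ψ(x) - |x - y|² / (2τ)`, as a set. -/
def argmaxSet (τ : ℝ) (ψ : C(X, ℝ)) (y : X) : Set X :=
  {x | ∀ z, ψ z - quadCost τ z y ≤ ψ x - quadCost τ x y}

theorem argminSet_nonempty (τ : ℝ) (φ : C(X, ℝ)) (x : X) : (argminSet τ φ x).Nonempty := by
  have h : Continuous (fun y : X => φ y + quadCost τ x y) :=
    φ.continuous.add ((continuous_quadCost τ).comp (by fun_prop : Continuous fun y : X => (x, y)))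
  obtain ⟨y, -, hy⟩ := isCompact_univ.exists_isMinOn ⟨x, Set.mem_univ x⟩ h.continuousOn
  exact ⟨y, fun z => hy (Set.mem_univ z)⟩

theorem argmaxSet_nonempty (τ : ℝ) (ψ : C(X, ℝ)) (y : X) : (argmaxSet τ ψ y).Nonempty := by
  have h : Continuous (fun x : X => ψ x - quadCost τ x y) :=
    ψ.continuous.sub ((continuous_quadCost τ).comp (by fun_prop : Continuous fun x : X => (x, y)))
  obtain ⟨x, -, hx⟩ := isCompact_univ.exists_isMaxOn ⟨y, Set.mem_univ y⟩ h.continuousOn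
  exact ⟨x, fun z => hx (Set.mem_univ z)⟩

/-- `T_φ(x) = argmin_y φ(y) + |x - y|² / (2τ)`; where the minimizer is not unique, some minimizer. -/
def mapT (τ : ℝ) (φ : C(X, ℝ)) (x : X) : X := (argminSet_nonempty τ φ x).some

/-- `S_ψ(y) = argmax_x ψ(x) - |x - y|² / (2τ)`; where the maximizer is not unique, some maximizer. -/
def mapS (τ : ℝ) (ψ : C(X, ℝ)) (y : X) : X := (argmaxSet_nonempty τ ψ y).some

end Transforms

/-! ### Extended-real-valued functionals -/

section Functionals

/-- Convexity of a functional with values in `ℝ ∪ {+∞}`. -/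
def ConvexFunctional {V : Type*} [AddCommGroup V] [Module ℝ V] (F : V → EReal) : Prop :=
  ∀ v w : V, ∀ a b : ℝ, 0 ≤ a → 0 ≤ b → a + b = 1 →
    F (a • v + b • w) ≤ (a : EReal) * F v + (b : EReal) * F w

/-- Concavity of a functional with values in `ℝ ∪ {-∞}`. -/
def ConcaveFunctional {V : Type*} [AddCommGroup V] [Module ℝ V] (F : V → EReal) : Prop :=
  ∀ v w : V, ∀ a b : ℝ, 0 ≤ a → 0 ≤ b → a + b = 1 →
    (a : EReal) * F v + (b : EReal) * F w ≤ F (a • v + b • w)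

/-- Properness of a convex functional: never `-∞`, somewhere finite. -/
def ProperConvex {V : Type*} (F : V → EReal) : Prop := (∀ v, F v ≠ ⊥) ∧ ∃ v, F v ≠ ⊤

/-- Properness of a concave functional: never `+∞`, somewhere finite. -/
def ProperConcave {V : Type*} (F : V → EReal) : Prop := (∀ v, F v ≠ ⊤) ∧ ∃ v, F v ≠ ⊥

/-- Upper semicontinuity for the weak topology of `V`. -/
def WeaklyUpperSemicontinuous {V : Type*} [AddCommGroup V] [Module ℝ V] [TopologicalSpace V]
    (F : V → EReal) : Prop :=
  UpperSemicontinuous fun v : WeakSpace ℝ V => F ((toWeakSpace ℝ V).symm v)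

/-- `L` is the first variation of `F` at `v`: `L` is a bounded linear functional and, for every
direction `h`, `t ↦ F (v + t h)` is finite near `t = 0` with derivative `L h` at `t = 0`. -/
def HasFirstVariation {V : Type*} [NormedAddCommGroup V] [NormedSpace ℝ V]
    (F : V → EReal) (v : V) (L : V → ℝ) : Prop :=
  IsBoundedLinearMap ℝ L ∧ ∀ h : V,
    (∀ᶠ t : ℝ in 𝓝 0, F (v + t • h) ≠ ⊥ ∧ F (v + t • h) ≠ ⊤) ∧
      HasDerivAt (fun t : ℝ => (F (v + t • h)).toReal) (L h) 0

end Functionals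

/-! ### Bounded open sets, densities and the dual functionals -/

/-- A bounded open subset `Ω` of `ℝ^d`. -/
structure BoundedOpenSet (d : ℕ) where
  carrier : Set (EuclideanSpace ℝ (Fin d))
  isOpen : IsOpen carrier
  isBounded : Bornology.IsBounded carrier

namespace BoundedOpenSet

variable {d : ℕ} (Ω : BoundedOpenSet d)

/-- The closure of `Ω`, as a type. -/
abbrev Cl : Type := closure Ω.carrier

instance : CompactSpace Ω.Cl := isCompact_iff_compactSpace.mp Ω.isBounded.isCompact_closure

/-- Lebesgue measure of `Ω`, carried by the closure of `Ω` (the boundary has measure zero). -/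
def leb : Measure Ω.Cl :=
  ((volume : Measure (EuclideanSpace ℝ (Fin d))).restrict Ω.carrier).comap Subtype.val

instance : IsFiniteMeasure Ω.leb := by
  refine ⟨?_⟩
  have h := (MeasurableEmbedding.subtype_coe
    (isClosed_closure (s := Ω.carrier)).measurableSet).comap_apply
    ((volume : Measure (EuclideanSpace ℝ (Fin d))).restrict Ω.carrier) Set.univ
  rw [leb, h]
  refine (measure_mono (Set.subset_univ _)).trans_lt ?_
  simpa using Ω.isBounded.measure_lt_top

/-- `L¹(Ω)`. -/
abbrev L1 : Type := Lp ℝ 1 Ω.leb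

/-- `L^∞(Ω)`. -/
abbrev LInf : Type := Lp ℝ ⊤ Ω.leb

/-- The inclusion of continuous functions on the closure of `Ω` into `L^∞(Ω)`. -/
def toLInf (φ : C(Ω.Cl, ℝ)) : Ω.LInf := ContinuousMap.toLp ⊤ Ω.leb ℝ φ

variable {Ω}

/-- Standing assumption on the energy `U : L¹(Ω) → ℝ ∪ {+∞}`: proper, convex, lower semicontinuous,
and `+∞` at every `ρ` that is negative on a set of positive measure. -/
structure IsInternalEnergy (U : Ω.L1 → EReal) : Prop where
  proper : ProperConvex U
  convex : ConvexFunctional U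
  lsc : LowerSemicontinuous U
  eq_top_of_neg : ∀ ρ : Ω.L1, Ω.leb {x | ρ x < 0} ≠ 0 → U ρ = ⊤

/-- The convex conjugate `U*(φ) = sup_ρ ∫ φ ρ - U(ρ)` on `L^∞(Ω)`. -/
def conjugate (U : Ω.L1 → EReal) (φ : Ω.LInf) : EReal :=
  ⨆ ρ : Ω.L1, ((∫ x, φ x * ρ x ∂Ω.leb : ℝ) : EReal) - U ρ

/-- `J(φ) = ∫ φᶜ μ - U*(φ)`. -/
def dualJ (τ : ℝ) (U : Ω.L1 → EReal) (μ : Ω.L1) (φ : C(Ω.Cl, ℝ)) : EReal :=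
  ((∫ x, backwardTransform τ φ x * μ x ∂Ω.leb : ℝ) : EReal) - conjugate U (Ω.toLInf φ)

/-- `I(ψ) = ∫ ψ μ - U*(ψ^c̄)`. -/
def dualI (τ : ℝ) (U : Ω.L1 → EReal) (μ : Ω.L1) (ψ : C(Ω.Cl, ℝ)) : EReal :=
  ((∫ x, ψ x * μ x ∂Ω.leb : ℝ) : EReal) - conjugate U (Ω.toLInf (forwardTransform τ ψ))

/-- `U*` has the density `ρ ∈ L¹(Ω)` as its first variation at `φ ∈ L^∞(Ω)`, that is
`δU*(φ) = ρ`, where `ρ` acts on `h ∈ L^∞(Ω)` by `∫ h ρ`. -/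
def IsFirstVariationConjugate (U : Ω.L1 → EReal) (φ : Ω.LInf) (ρ : Ω.L1) : Prop :=
  HasFirstVariation (conjugate U) φ fun h => ∫ x, h x * ρ x ∂Ω.leb

/-- The push-forward `T_# ρ` of a nonnegative density `ρ` by a map `T` of the closure of `Ω`. -/
def pushforward (T : Ω.Cl → Ω.Cl) (ρ : Ω.L1) : Measure Ω.Cl :=
  (Ω.leb.withDensity fun x => ENNReal.ofReal (ρ x)).map T

end BoundedOpenSet

end

noncomputable section

/-! ### The `c`-transforms and their envelope derivative -/

section Transforms

variable {X : Type*} [MetricSpace X]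

/-! The transform `φᶜ` is an infimum of functions affine in `φ`, hence concave and 1-Lipschitz in
the sup norm; by symmetry of the cost, `ψ^c̄ = -(-ψ)ᶜ`. Only nonnegative densities have finite
energy, so `U*` is monotone and a supremum of real affine functionals. Thus `J` and `I` are infima
of continuous concave functionals, which are weakly upper semicontinuous by Mazur. A Hahn-Banach
affine minorant of `U` makes `U*` finite at a constant. The inequalities `φ^{c c̄} ≤ φ` and `ψ ≤
ψ^{c̄ c}` give equal suprema.

Up to a quadratic term, `φᶜ` is a Lipschitz infimum of affine functions. At its points of
differentiability, almost all points by Rademacher, the gradient determines the minimizer. There the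
envelope theorem gives the derivative `u (T_φ x)`, and dominated convergence integrates it
(`hasDerivAt_integral_backwardTransform`).

For `I` the chain rule is not available: `U*` is differentiable only along lines, and the difference
quotients of `(ψ + t u)^c̄` need not converge in `L^∞`. Instead monotonicity of `U*` traps it
between its values along lines: below in the direction `u ∘ S_ψ`, above in the direction of a fixed
difference quotient, whose slope tends to the right limit (`hasDerivAt_zero_of_sandwich`). -/

theorem quadCost_comm (τ : ℝ) (x y : X) : quadCost τ x y = quadCost τ y x := by
  simp only [quadCost, dist_comm]

theorem argmaxSet_eq_argminSet_neg (τ : ℝ) (ψ : C(X, ℝ)) (y : X) :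
    argmaxSet τ ψ y = argminSet τ (-ψ) y := by
  ext x
  simp only [argmaxSet, argminSet, Set.mem_ofPred_eq, ContinuousMap.neg_apply]
  refine forall_congr' fun z => ?_
  rw [quadCost_comm τ z y, quadCost_comm τ x y]
  constructor <;> intro h <;> linarith

variable [CompactSpace X]

theorem backwardTransform_le (τ : ℝ) (φ : C(X, ℝ)) (x y : X) :
    backwardTransform τ φ x ≤ φ y + quadCost τ x y := by
  obtain ⟨z, hz⟩ := argminSet_nonempty τ φ x
  exact ciInf_le ⟨_, Set.forall_mem_range.2 hz⟩ y

theorem backwardTransform_eq_of_mem {τ : ℝ} {φ : C(X, ℝ)} {x y : X} (hy : y ∈ argminSet τ φ x) :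
    backwardTransform τ φ x = φ y + quadCost τ x y :=
  le_antisymm (backwardTransform_le τ φ x y) (by
    have : Nonempty X := ⟨x⟩
    exact le_ciInf hy)

theorem mapT_mem (τ : ℝ) (φ : C(X, ℝ)) (x : X) : mapT τ φ x ∈ argminSet τ φ x :=
  (argminSet_nonempty τ φ x).some_mem

theorem mapS_mem (τ : ℝ) (ψ : C(X, ℝ)) (y : X) : mapS τ ψ y ∈ argmaxSet τ ψ y :=
  (argmaxSet_nonempty τ ψ y).some_mem

theorem backwardTransform_eq_mapT (τ : ℝ) (φ : C(X, ℝ)) (x : X) :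
    backwardTransform τ φ x = φ (mapT τ φ x) + quadCost τ x (mapT τ φ x) :=
  backwardTransform_eq_of_mem (mapT_mem τ φ x)

theorem mapS_eq_mapT_neg (τ : ℝ) (ψ : C(X, ℝ)) : mapS τ ψ = mapT τ (-ψ) := by
  ext1 y
  simp only [mapS, mapT, argmaxSet_eq_argminSet_neg]

/-- The cost is symmetric, so a sign change turns the supremum into an infimum. Continuity,
convexity and differentiability of the forward transform are read off from the backward one. -/
theorem forwardTransform_eq_neg (τ : ℝ) (ψ : C(X, ℝ)) :
    forwardTransform τ ψ = -backwardTransform τ (-ψ) := by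
  ext y
  have hy := mapS_mem τ ψ y
  have h : backwardTransform τ (-ψ) y = _ :=
    backwardTransform_eq_of_mem (argmaxSet_eq_argminSet_neg τ ψ y ▸ hy)
  rw [ContinuousMap.neg_apply, h, ContinuousMap.neg_apply, quadCost_comm]
  have : Nonempty X := ⟨y⟩
  refine le_antisymm (ciSup_le fun z => ?_) ?_
  · have := hy z
    linarith
  · have : _ ≤ forwardTransform τ ψ y := le_ciSup (f := fun x => ψ x - quadCost τ x y)
      ⟨_, Set.forall_mem_range.2 hy⟩ (mapS τ ψ y)
    linarith

theorem le_forwardTransform (τ : ℝ) (ψ : C(X, ℝ)) (x y : X) :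
    ψ x - quadCost τ x y ≤ forwardTransform τ ψ y := by
  have := backwardTransform_le τ (-ψ) y x
  rw [forwardTransform_eq_neg, ContinuousMap.neg_apply, quadCost_comm τ x y]
  rw [ContinuousMap.neg_apply] at this
  linarith

theorem forwardTransform_eq_mapS (τ : ℝ) (ψ : C(X, ℝ)) (y : X) :
    forwardTransform τ ψ y = ψ (mapS τ ψ y) - quadCost τ (mapS τ ψ y) y := by
  rw [forwardTransform_eq_neg, ContinuousMap.neg_apply, backwardTransform_eq_mapT,
    mapS_eq_mapT_neg, ContinuousMap.neg_apply, quadCost_comm]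
  ring

theorem forwardTransform_backwardTransform_le (τ : ℝ) (φ : C(X, ℝ)) (y : X) :
    forwardTransform τ (backwardTransform τ φ) y ≤ φ y := by
  rw [forwardTransform_eq_mapS]
  linarith [backwardTransform_le τ φ (mapS τ (backwardTransform τ φ) y) y]

theorem le_backwardTransform_forwardTransform (τ : ℝ) (ψ : C(X, ℝ)) (x : X) :
    ψ x ≤ backwardTransform τ (forwardTransform τ ψ) x := by
  rw [backwardTransform_eq_mapT]
  linarith [le_forwardTransform τ ψ x (mapT τ (forwardTransform τ ψ) x)]

theorem abs_backwardTransform_sub_le (τ : ℝ) (φ φ' : C(X, ℝ)) (x : X) :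
    |backwardTransform τ φ x - backwardTransform τ φ' x| ≤ ‖φ - φ'‖ := by
  have key : ∀ y : X, |φ y - φ' y| ≤ ‖φ - φ'‖ := fun y => (φ - φ').norm_coe_le_norm y
  rw [abs_le]
  constructor
  · rw [backwardTransform_eq_mapT τ φ]
    linarith [backwardTransform_le τ φ' x (mapT τ φ x), (abs_le.1 (key (mapT τ φ x))).1]
  · rw [backwardTransform_eq_mapT τ φ']
    linarith [backwardTransform_le τ φ x (mapT τ φ' x), (abs_le.1 (key (mapT τ φ' x))).2]

theorem lipschitzWith_backwardTransform (τ : ℝ) :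
    LipschitzWith 1 (backwardTransform τ : C(X, ℝ) → C(X, ℝ)) := by
  refine LipschitzWith.of_dist_le_mul fun φ φ' => ?_
  rw [NNReal.coe_one, one_mul, ContinuousMap.dist_le dist_nonneg, dist_eq_norm]
  exact fun x => abs_backwardTransform_sub_le τ φ φ' x

theorem continuous_forwardTransform (τ : ℝ) :
    Continuous (forwardTransform τ : C(X, ℝ) → C(X, ℝ)) := by
  have : (forwardTransform τ : C(X, ℝ) → C(X, ℝ)) = fun ψ => -backwardTransform τ (-ψ) :=
    funext (forwardTransform_eq_neg τ)
  rw [this]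
  exact ((lipschitzWith_backwardTransform τ).continuous.comp continuous_neg).neg

theorem backwardTransform_concave (τ : ℝ) (φ φ' : C(X, ℝ)) {a b : ℝ} (ha : 0 ≤ a) (hb : 0 ≤ b)
    (hab : a + b = 1) (x : X) :
    a * backwardTransform τ φ x + b * backwardTransform τ φ' x ≤
      backwardTransform τ (a • φ + b • φ') x := by
  rw [backwardTransform_eq_mapT τ (a • φ + b • φ')]
  set y := mapT τ (a • φ + b • φ') x
  have h1 := mul_le_mul_of_nonneg_left (backwardTransform_le τ φ x y) ha
  have h2 := mul_le_mul_of_nonneg_left (backwardTransform_le τ φ' x y) hb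
  have h3 : quadCost τ x y = a * quadCost τ x y + b * quadCost τ x y := by
    rw [← add_mul, hab, one_mul]
  simp only [ContinuousMap.add_apply, ContinuousMap.smul_apply, smul_eq_mul]
  linarith

theorem forwardTransform_convex (τ : ℝ) (ψ ψ' : C(X, ℝ)) {a b : ℝ} (ha : 0 ≤ a) (hb : 0 ≤ b)
    (hab : a + b = 1) (y : X) :
    forwardTransform τ (a • ψ + b • ψ') y ≤
      a * forwardTransform τ ψ y + b * forwardTransform τ ψ' y := by
  have h := backwardTransform_concave τ (-ψ) (-ψ') ha hb hab y
  have e : a • -ψ + b • -ψ' = -(a • ψ + b • ψ') := by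
    rw [smul_neg, smul_neg, neg_add]
  rw [e] at h
  simp only [forwardTransform_eq_neg, ContinuousMap.neg_apply]
  linarith

theorem forwardTransform_const_le {τ : ℝ} (hτ : 0 < τ) (c : ℝ) (y : X) :
    forwardTransform τ (ContinuousMap.const X c) y ≤ c := by
  rw [forwardTransform_eq_mapS, ContinuousMap.const_apply]
  have : 0 ≤ quadCost τ (mapS τ (ContinuousMap.const X c) y) y := by
    unfold quadCost
    positivity
  linarith

/-- Projection along a compact factor is a closed map, so the parameters related to some point
outside `W` form a closed set; uniqueness keeps `p` out of it. -/
theorem continuousAt_of_isClosed_of_unique {P Y : Type*} [TopologicalSpace P] [TopologicalSpace Y]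
    [CompactSpace Y] {G : Set (P × Y)} (hG : IsClosed G) {f : P → Y} (hf : ∀ p, (p, f p) ∈ G)
    {p : P} (hp : ∀ y, (p, y) ∈ G → y = f p) : ContinuousAt f p := by
  intro V hV
  obtain ⟨W, hWV, hW, hpW⟩ := mem_nhds_iff.1 hV
  have hcl : IsClosed (Prod.fst '' (G ∩ Prod.snd ⁻¹' Wᶜ)) :=
    isClosedMap_fst_of_compactSpace _ (hG.inter (hW.isClosed_compl.preimage continuous_snd))
  have hpn : p ∉ Prod.fst '' (G ∩ Prod.snd ⁻¹' Wᶜ) := by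
    rintro ⟨⟨p', y⟩, ⟨h1, h2⟩, rfl⟩
    exact h2 (by rwa [hp y h1])
  rw [mem_map]
  filter_upwards [hcl.isOpen_compl.mem_nhds hpn] with q hq
  by_contra hqV
  exact hq ⟨(q, f q), ⟨hf q, fun h => hqV (hWV h)⟩, rfl⟩

/-- Joint continuity serves twice: in `φ` for the envelope derivative, in `x` for measurability. -/
theorem continuousAt_uncurry_mapT {τ : ℝ} {φ : C(X, ℝ)} {x : X}
    (h : ∃! y, y ∈ argminSet τ φ x) :
    ContinuousAt (fun p : C(X, ℝ) × X => mapT τ p.1 p.2) (φ, x) := by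
  have hc := continuous_quadCost (X := X) τ
  refine continuousAt_of_isClosed_of_unique
    (G := {q : (C(X, ℝ) × X) × X | q.2 ∈ argminSet τ q.1.1 q.1.2}) ?_
    (fun p => mapT_mem τ p.1 p.2) (fun y hy => h.unique hy (mapT_mem τ φ x))
  have hG : {q : (C(X, ℝ) × X) × X | q.2 ∈ argminSet τ q.1.1 q.1.2} =
      ⋂ z, {q | q.1.1 q.2 + quadCost τ q.1.2 q.2 ≤ q.1.1 z + quadCost τ q.1.2 z} := by
    ext q
    simp only [argminSet, Set.mem_ofPred_eq, Set.mem_iInter]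
  rw [hG]
  have key : ∀ w : (C(X, ℝ) × X) × X → X, Continuous w →
      Continuous fun q : (C(X, ℝ) × X) × X => q.1.1 (w q) + quadCost τ q.1.2 (w q) := by
    intro w hw
    have h1 : Continuous fun q : (C(X, ℝ) × X) × X => (q.1.2, w q) :=
      (continuous_snd.comp continuous_fst).prodMk hw
    exact ((continuous_fst.comp continuous_fst).eval hw).add (hc.comp h1)
  exact isClosed_iInter fun z => isClosed_le (key _ continuous_snd) (key _ continuous_const)

/-- Envelope theorem: to first order, the motion of the minimizer does not contribute. -/
theorem hasDerivAt_backwardTransform {τ : ℝ} {φ : C(X, ℝ)} {x : X}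
    (h : ∃! y, y ∈ argminSet τ φ x) (u : C(X, ℝ)) :
    HasDerivAt (fun t : ℝ => backwardTransform τ (φ + t • u) x) (u (mapT τ φ x)) 0 := by
  have hT : Tendsto (fun t : ℝ => u (mapT τ (φ + t • u) x)) (𝓝 0) (𝓝 (u (mapT τ φ x))) := by
    have h1 : Tendsto (fun t : ℝ => (φ + t • u, x)) (𝓝 0) (𝓝 (φ, x)) := by
      have : Continuous fun t : ℝ => (φ + t • u, x) :=
        (continuous_const.add (continuous_id.smul continuous_const)).prodMk continuous_const
      simpa using this.tendsto 0
    have h2 : Tendsto (fun p : C(X, ℝ) × X => u (mapT τ p.1 p.2)) (𝓝 (φ, x))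
        (𝓝 (u (mapT τ φ x))) :=
      (u.continuous.tendsto (mapT τ φ x)).comp (continuousAt_uncurry_mapT h)
    exact (Tendsto.comp h2 h1 :)
  rw [hasDerivAt_iff_isLittleO_nhds_zero, Asymptotics.isLittleO_iff]
  intro ε hε
  filter_upwards [Metric.tendsto_nhds.1 hT ε hε] with t ht
  rw [Real.dist_eq, abs_lt] at ht
  simp only [zero_add, zero_smul, add_zero, smul_eq_mul]
  -- Each infimum is tested at the minimizer of the other, which traps the increment between `t * v`
  -- and `t * w` for either sign of `t`.
  have hup := backwardTransform_le τ (φ + t • u) x (mapT τ φ x)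
  have hlo := backwardTransform_le τ φ x (mapT τ (φ + t • u) x)
  have e0 := backwardTransform_eq_mapT τ φ x
  have et := backwardTransform_eq_mapT τ (φ + t • u) x
  simp only [ContinuousMap.add_apply, ContinuousMap.smul_apply, smul_eq_mul] at hup et
  set v := u (mapT τ (φ + t • u) x)
  set w := u (mapT τ φ x)
  have hvw : |v - w| ≤ ε := abs_le.2 ⟨ht.1.le, ht.2.le⟩
  have hb : |t * (v - w)| ≤ ε * |t| := by
    rw [abs_mul, mul_comm]
    exact mul_le_mul_of_nonneg_right hvw (abs_nonneg t)
  have hb' := (abs_le.1 hb).1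
  rw [Real.norm_eq_abs, Real.norm_eq_abs, abs_le]
  have hpos : 0 ≤ ε * |t| := by positivity
  constructor <;> nlinarith

end Transforms

/-! ### Almost everywhere uniqueness and measurability of the optimal maps -/

namespace BoundedOpenSet

variable {d : ℕ} {Ω : BoundedOpenSet d}

theorem ae_leb_of_ae_volume {p : EuclideanSpace ℝ (Fin d) → Prop} (h : ∀ᵐ z, p z) :
    ∀ᵐ x : Ω.Cl ∂Ω.leb, p x := by
  have he := MeasurableEmbedding.subtype_coe (isClosed_closure (s := Ω.carrier)).measurableSet
  have h1 : ∀ᵐ z ∂(Ω.leb.map Subtype.val), p z := by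
    rw [leb, he.map_comap]
    exact ae_restrict_of_ae (ae_restrict_of_ae h)
  exact he.ae_map_iff.1 h1

/-- `φᶜ(z) - |z|² / (2τ)`, extended to the whole space. -/
def reducedTransform (τ : ℝ) (φ : C(Ω.Cl, ℝ)) (z : EuclideanSpace ℝ (Fin d)) : ℝ :=
  ⨅ y : Ω.Cl, (φ y + ‖(y : EuclideanSpace ℝ (Fin d))‖ ^ 2 / (2 * τ)
    - inner ℝ (y : EuclideanSpace ℝ (Fin d)) z / τ)

theorem reducedTransform_le (τ : ℝ) (φ : C(Ω.Cl, ℝ)) (z : EuclideanSpace ℝ (Fin d)) (y : Ω.Cl) :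
    reducedTransform τ φ z ≤ φ y + ‖(y : EuclideanSpace ℝ (Fin d))‖ ^ 2 / (2 * τ)
      - inner ℝ (y : EuclideanSpace ℝ (Fin d)) z / τ :=
  ciInf_le (isCompact_range (by fun_prop)).bddBelow y

/-- With the term in `|z|²` removed, the competitors are affine in `z` with slopes `-y / τ`, bounded
by `R / τ`. Being Lipschitz on the whole space allows Rademacher's theorem. -/
theorem exists_lipschitzWith_reducedTransform [Nonempty Ω.Cl] {τ : ℝ} (hτ : 0 < τ)
    (φ : C(Ω.Cl, ℝ)) : ∃ K, LipschitzWith K (reducedTransform τ φ) := by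
  obtain ⟨R, hR0, hR⟩ := Ω.isBounded.closure.exists_pos_norm_le
  refine ⟨Real.toNNReal (R / τ), LipschitzWith.of_le_add_mul _ fun z w => ?_⟩
  rw [← sub_le_iff_le_add]
  refine le_ciInf fun y => ?_
  have h1 := reducedTransform_le τ φ z y
  have h2 : inner ℝ (y : EuclideanSpace ℝ (Fin d)) (w - z) ≤ R * dist z w := by
    rw [dist_comm, dist_eq_norm]
    exact (real_inner_le_norm _ _).trans
      (mul_le_mul_of_nonneg_right (hR _ y.2) (norm_nonneg _))
  have h3 := div_le_div_of_nonneg_right h2 hτ.le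
  rw [inner_sub_right, sub_div, mul_div_right_comm] at h3
  rw [Real.coe_toNNReal _ (by positivity)]
  linarith

theorem quadCost_eq_inner {τ : ℝ} (hτ : 0 < τ) (x y : Ω.Cl) :
    quadCost τ x y = ‖(y : EuclideanSpace ℝ (Fin d))‖ ^ 2 / (2 * τ)
      - inner ℝ (y : EuclideanSpace ℝ (Fin d)) (x : EuclideanSpace ℝ (Fin d)) / τ
      + ‖(x : EuclideanSpace ℝ (Fin d))‖ ^ 2 / (2 * τ) := by
  rw [quadCost, Subtype.dist_eq, dist_comm, dist_eq_norm, norm_sub_sq_real]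
  field_simp

theorem reducedTransform_eq_of_mem {τ : ℝ} (hτ : 0 < τ) {φ : C(Ω.Cl, ℝ)} {x y : Ω.Cl}
    (hy : y ∈ argminSet τ φ x) :
    reducedTransform τ φ x = φ y + ‖(y : EuclideanSpace ℝ (Fin d))‖ ^ 2 / (2 * τ)
      - inner ℝ (y : EuclideanSpace ℝ (Fin d)) (x : EuclideanSpace ℝ (Fin d)) / τ := by
  have : Nonempty Ω.Cl := ⟨x⟩
  refine le_antisymm (reducedTransform_le τ φ x y) (le_ciInf fun z => ?_)
  have h := hy z
  rw [quadCost_eq_inner hτ, quadCost_eq_inner hτ] at h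
  linarith

/-- The affine function of a minimizer `y` touches the infimum from above at `x`, so the gradient
there can only be `-y / τ`. -/
theorem fderiv_reducedTransform {τ : ℝ} (hτ : 0 < τ) {φ : C(Ω.Cl, ℝ)} {x y : Ω.Cl}
    (hy : y ∈ argminSet τ φ x) (hd : DifferentiableAt ℝ (reducedTransform τ φ) x) :
    fderiv ℝ (reducedTransform τ φ) x + τ⁻¹ • innerSL ℝ (y : EuclideanSpace ℝ (Fin d)) = 0 := by
  have hmax : IsLocalMax (fun z => reducedTransform τ φ z
      + τ⁻¹ • innerSL ℝ (y : EuclideanSpace ℝ (Fin d)) z) x := by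
    refine Eventually.of_forall fun z => ?_
    have h1 := reducedTransform_le τ φ z y
    have h2 := reducedTransform_eq_of_mem hτ hy
    simp only [innerSL_apply_apply, smul_eq_mul]
    rw [div_eq_inv_mul] at h1 h2
    rw [div_eq_inv_mul (inner ℝ _ _)] at h1 h2
    linarith
  exact hmax.hasFDerivAt_eq_zero (hd.hasFDerivAt.add
    ((innerSL ℝ (y : EuclideanSpace ℝ (Fin d))).hasFDerivAt.const_smul τ⁻¹))

theorem ae_existsUnique_argmin {τ : ℝ} (hτ : 0 < τ) (φ : C(Ω.Cl, ℝ)) :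
    ∀ᵐ x ∂Ω.leb, ∃! y, y ∈ argminSet τ φ x := by
  rcases isEmpty_or_nonempty Ω.Cl with h | h
  · exact Eventually.of_forall fun x => isEmptyElim x
  obtain ⟨K, hK⟩ := exists_lipschitzWith_reducedTransform hτ φ
  filter_upwards [ae_leb_of_ae_volume (Ω := Ω) (hK.ae_differentiableAt (μ := volume))] with x hx
  refine ⟨mapT τ φ x, mapT_mem τ φ x, fun y hy => ?_⟩
  have h1 := fderiv_reducedTransform hτ hy hx
  have h2 := fderiv_reducedTransform hτ (mapT_mem τ φ x) hx
  have h3 := smul_right_injective _ (inv_ne_zero hτ.ne') (add_left_cancel (h1.trans h2.symm))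
  refine Subtype.ext (ext_inner_right ℝ fun v => ?_)
  simpa using DFunLike.congr_fun h3 v

theorem ae_existsUnique_argmax {τ : ℝ} (hτ : 0 < τ) (ψ : C(Ω.Cl, ℝ)) :
    ∀ᵐ y ∂Ω.leb, ∃! x, x ∈ argmaxSet τ ψ y := by
  simp only [argmaxSet_eq_argminSet_neg]
  exact ae_existsUnique_argmin hτ (-ψ)

/-- The map is continuous on the complement of a measurable null set containing every point with
several minimizers, so the arbitrary choice made there is harmless. -/
theorem aemeasurable_mapT {τ : ℝ} (hτ : 0 < τ) (φ : C(Ω.Cl, ℝ)) :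
    AEMeasurable (mapT τ φ) Ω.leb := by
  obtain ⟨s, hs, hsm, hs0⟩ := exists_measurable_superset_of_null
    (ae_iff.1 (ae_existsUnique_argmin hτ φ))
  have hc : ContinuousOn (mapT τ φ) sᶜ := by
    intro x hx
    have hux : ∃! y, y ∈ argminSet τ φ x := by
      by_contra hcon
      exact hx (hs hcon)
    have h1 : ContinuousAt (fun z : Ω.Cl => (φ, z)) x :=
      (continuous_const.prodMk continuous_id).continuousAt
    have h2 := ContinuousAt.comp (f := fun z : Ω.Cl => (φ, z)) (x := x)
      (continuousAt_uncurry_mapT hux) h1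
    exact h2.continuousWithinAt
  have h1 := hc.aemeasurable (μ := Ω.leb) hsm.compl
  have h2 : ∀ᵐ x ∂Ω.leb, x ∈ sᶜ := measure_eq_zero_iff_ae_notMem.1 hs0
  rwa [Measure.restrict_eq_self_of_ae_mem h2] at h1

theorem aemeasurable_mapS {τ : ℝ} (hτ : 0 < τ) (ψ : C(Ω.Cl, ℝ)) :
    AEMeasurable (mapS τ ψ) Ω.leb := by
  rw [mapS_eq_mapT_neg]
  exact aemeasurable_mapT hτ (-ψ)

/-! ### Integration against densities and push-forwards -/

theorem integrable_L1 (ρ : Ω.L1) : Integrable ρ Ω.leb := L1.integrable_coeFn ρ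

theorem integrable_continuous_mul (u : C(Ω.Cl, ℝ)) (ρ : Ω.L1) :
    Integrable (fun x => u x * ρ x) Ω.leb :=
  (integrable_L1 ρ).bdd_mul u.continuous.aestronglyMeasurable
    (Eventually.of_forall u.norm_coe_le_norm)

theorem integral_pushforward {T : Ω.Cl → Ω.Cl} (hT : AEMeasurable T Ω.leb) {ρ : Ω.L1}
    (hρ : 0 ≤ ρ) (u : C(Ω.Cl, ℝ)) :
    ∫ y, u y ∂(pushforward T ρ) = ∫ x, u (T x) * ρ x ∂Ω.leb := by
  rw [pushforward, integral_map (hT.mono_ac (withDensity_absolutelyContinuous _ _))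
    u.continuous.aestronglyMeasurable,
    integral_withDensity_eq_integral_toReal_smul₀
      (Lp.aestronglyMeasurable ρ).aemeasurable.ennreal_ofReal
      (Eventually.of_forall fun _ => ENNReal.ofReal_lt_top)]
  refine integral_congr_ae ?_
  -- `ENNReal.ofReal` discards negative values, hence the need for `0 ≤ ρ`.
  filter_upwards [(Lp.coeFn_nonneg ρ).2 hρ] with x hx
  rw [ENNReal.toReal_ofReal hx, smul_eq_mul, mul_comm]

theorem integrable_comp_mul {T : Ω.Cl → Ω.Cl} (hT : AEMeasurable T Ω.leb) (ρ : Ω.L1)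
    (u : C(Ω.Cl, ℝ)) : Integrable (fun x => u (T x) * ρ x) Ω.leb :=
  (integrable_L1 ρ).bdd_mul (u.continuous.measurable.comp_aemeasurable hT).aestronglyMeasurable
    (Eventually.of_forall fun _ => u.norm_coe_le_norm _)

theorem isBoundedLinearMap_integral_comp_mul {T : Ω.Cl → Ω.Cl} (hT : AEMeasurable T Ω.leb)
    (ρ : Ω.L1) : IsBoundedLinearMap ℝ fun u : C(Ω.Cl, ℝ) => ∫ x, u (T x) * ρ x ∂Ω.leb := by
  refine IsLinearMap.with_bound ⟨fun u v => ?_, fun c u => ?_⟩ (∫ x, |ρ x| ∂Ω.leb) fun u => ?_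
  · rw [← integral_add (integrable_comp_mul hT ρ u) (integrable_comp_mul hT ρ v)]
    simp only [ContinuousMap.add_apply, add_mul]
  · rw [smul_eq_mul, ← integral_const_mul]
    simp only [ContinuousMap.smul_apply, smul_eq_mul, mul_assoc]
  · refine (norm_integral_le_integral_norm _).trans ?_
    rw [← integral_mul_const]
    refine integral_mono (integrable_comp_mul hT ρ u).norm
      ((integrable_L1 ρ).abs.mul_const _) fun x => ?_
    simp only [norm_mul, Real.norm_eq_abs (ρ x)]
    rw [mul_comm]
    exact mul_le_mul_of_nonneg_left (u.norm_coe_le_norm _) (abs_nonneg _)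

theorem isBoundedLinearMap_integral_mul (ρ : Ω.L1) :
    IsBoundedLinearMap ℝ fun u : C(Ω.Cl, ℝ) => ∫ x, u x * ρ x ∂Ω.leb :=
  isBoundedLinearMap_integral_comp_mul aemeasurable_id ρ

/-- The envelope derivative exists at almost every point, and the 1-Lipschitz bound dominates the
difference quotients by `‖u‖ * |ρ x|`. -/
theorem hasDerivAt_integral_backwardTransform {τ : ℝ} (hτ : 0 < τ) (φ u : C(Ω.Cl, ℝ))
    (ρ : Ω.L1) :
    HasDerivAt (fun t : ℝ => ∫ x, backwardTransform τ (φ + t • u) x * ρ x ∂Ω.leb)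
      (∫ x, u (mapT τ φ x) * ρ x ∂Ω.leb) 0 := by
  refine (hasDerivAt_integral_of_dominated_loc_of_lip (s := Set.univ)
    (bound := fun x => ‖u‖ * |ρ x|) univ_mem
    (Eventually.of_forall fun t => (integrable_continuous_mul _ ρ).aestronglyMeasurable)
    (integrable_continuous_mul _ ρ)
    (integrable_comp_mul (aemeasurable_mapT hτ φ) ρ u).aestronglyMeasurable
    (Eventually.of_forall fun x => ?_) ((integrable_L1 ρ).abs.const_mul _) ?_).2
  · refine LipschitzOnWith.of_dist_le_mul fun s _ t _ => ?_
    have h := abs_backwardTransform_sub_le τ (φ + s • u) (φ + t • u) x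
    have e : φ + s • u - (φ + t • u) = (s - t) • u := by rw [sub_smul]; abel
    rw [e, norm_smul, Real.norm_eq_abs] at h
    rw [Real.dist_eq, Real.dist_eq, ← sub_mul, abs_mul, Real.coe_nnabs,
      abs_of_nonneg (by positivity : 0 ≤ ‖u‖ * |ρ x|)]
    calc _ ≤ |s - t| * ‖u‖ * |ρ x| := mul_le_mul_of_nonneg_right h (abs_nonneg _)
      _ = _ := by ring
  · filter_upwards [ae_existsUnique_argmin hτ φ] with x hx
    exact (hasDerivAt_backwardTransform hx u).mul_const _

end BoundedOpenSet

/-! ### Infima of concave functionals, and affine minorants -/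

section Functionals

theorem EReal.le_coe_sub_comm {b s : EReal} (a : ℝ) : b ≤ a - s ↔ s ≤ a - b := by
  induction b <;> induction s <;>
    simp [← EReal.coe_sub, le_sub_comm]

/-- For finite `a`, the map `s ↦ a - s` is its own order-reversing adjoint, so infinite values and
empty families need no separate treatment. -/
theorem EReal.coe_sub_iSup {ι : Sort*} (a : ℝ) (f : ι → EReal) :
    (a : EReal) - ⨆ i, f i = ⨅ i, ((a : EReal) - f i) := by
  refine eq_of_forall_le_iff fun b => ?_
  rw [EReal.le_coe_sub_comm, iSup_le_iff, le_iInf_iff]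
  exact forall_congr' fun i => (EReal.le_coe_sub_comm a).symm

theorem concaveFunctional_iInf {V ι : Type*} [AddCommGroup V] [Module ℝ V] {G : ι → V → ℝ}
    (hG : ∀ i, ConcaveOn ℝ Set.univ (G i)) :
    ConcaveFunctional fun v => ⨅ i, (G i v : EReal) := by
  intro v w a b ha hb hab
  refine le_iInf fun i => ?_
  have ha' : (0 : EReal) ≤ a := EReal.coe_nonneg.2 ha
  have hb' : (0 : EReal) ≤ b := EReal.coe_nonneg.2 hb
  calc (a : EReal) * (⨅ i, (G i v : EReal)) + b * ⨅ i, (G i w : EReal)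
      ≤ (a : EReal) * G i v + b * G i w := by
        gcongr
        · exact iInf_le _ i
        · exact iInf_le _ i
    _ = ((a * G i v + b * G i w : ℝ) : EReal) := by push_cast; rfl
    _ ≤ _ := EReal.coe_le_coe_iff.2 ((hG i).2 trivial trivial ha hb hab)

/-- Mazur: the superlevel sets are convex and norm closed, hence weakly closed. -/
theorem weaklyUpperSemicontinuous_coe {V : Type*} [NormedAddCommGroup V] [NormedSpace ℝ V]
    {G : V → ℝ} (hG : ConcaveOn ℝ Set.univ G) (hc : Continuous G) :
    WeaklyUpperSemicontinuous fun v => (G v : EReal) := by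
  rw [WeaklyUpperSemicontinuous, upperSemicontinuous_iff_isClosed_preimage]
  intro r
  induction r with
  | bot => simp
  | top =>
    have : (fun v : WeakSpace ℝ V => ((G ((toWeakSpace ℝ V).symm v) : ℝ) : EReal)) ⁻¹' Set.Ici ⊤
        = ∅ := by
      ext v
      simp
    rw [this]
    exact isClosed_empty
  | coe r =>
    have hconv : Convex ℝ {v | r ≤ G v} := by simpa using hG.convex_ge r
    have hcl : IsClosed {v | r ≤ G v} := isClosed_le continuous_const hc
    have h := hconv.toWeakSpace_closure ℝ
    rw [hcl.closure_eq] at h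
    have h2 := h ▸ isClosed_closure
    convert h2 using 1
    ext v
    rw [LinearEquiv.image_eq_preimage_symm]
    simp

theorem weaklyUpperSemicontinuous_iInf {V ι : Type*} [NormedAddCommGroup V] [NormedSpace ℝ V]
    {G : ι → V → ℝ} (hG : ∀ i, ConcaveOn ℝ Set.univ (G i)) (hc : ∀ i, Continuous (G i)) :
    WeaklyUpperSemicontinuous fun v => ⨅ i, (G i v : EReal) :=
  upperSemicontinuous_iInf fun i => weaklyUpperSemicontinuous_coe (hG i) (hc i)

/-- A hyperplane separating the closed convex epigraph from a point below the graph is not vertical;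
solving its equation for the last coordinate gives the minorant. -/
theorem exists_affine_le_of_lsc {V : Type*} [NormedAddCommGroup V] [NormedSpace ℝ V]
    {F : V → EReal} (hp : ProperConvex F) (hF : ConvexFunctional F) (hl : LowerSemicontinuous F) :
    ∃ (g : V →L[ℝ] ℝ) (C : ℝ), ∀ v, ((g v - C : ℝ) : EReal) ≤ F v := by
  obtain ⟨hbot, v₀, hv₀⟩ := hp
  set E : Set (V × ℝ) := {p | F p.1 ≤ p.2}
  have hcl : IsClosed E := hl.isClosed_epigraph.preimage
    (continuous_fst.prodMk (continuous_coe_real_ereal.comp continuous_snd))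
  have hconv : Convex ℝ E := by
    rintro ⟨v, s⟩ hv ⟨w, t⟩ hw a b ha hb hab
    have ha' : (0 : EReal) ≤ a := EReal.coe_nonneg.2 ha
    have hb' : (0 : EReal) ≤ b := EReal.coe_nonneg.2 hb
    have hv' : F v ≤ s := hv
    have hw' : F w ≤ t := hw
    calc F (a • v + b • w) ≤ (a : EReal) * F v + b * F w := hF v w a b ha hb hab
      _ ≤ (a : EReal) * s + b * t := by gcongr
      _ = ((a * s + b * t : ℝ) : EReal) := by push_cast; rfl
  have hr : ((F v₀).toReal : EReal) = F v₀ := EReal.coe_toReal hv₀ (hbot v₀)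
  have hnot : ((v₀, (F v₀).toReal - 1) : V × ℝ) ∉ E := by
    intro h
    replace h : F v₀ ≤ (((F v₀).toReal - 1 : ℝ) : EReal) := h
    have h' := hr.trans_le h
    rw [EReal.coe_le_coe_iff] at h'
    linarith
  obtain ⟨f, u, h0, h1⟩ := geometric_hahn_banach_point_closed hconv hcl hnot
  have hsplit : ∀ v t, f (v, t) = f (v, 0) + t * f (0, 1) := by
    intro v t
    have : ((v, t) : V × ℝ) = (v, 0) + t • (0, 1) := by simp
    rw [this, map_add, map_smul, smul_eq_mul]
  -- The excluded point and the graph point both lie over `v₀`, so only the vertical coefficient can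
  -- separate them.
  have hα : 0 < f (0, 1) := by
    have h2 := h1 (v₀, (F v₀).toReal) hr.ge
    rw [hsplit] at h0 h2
    nlinarith
  refine ⟨-((f (0, 1))⁻¹ • f.comp (ContinuousLinearMap.inl ℝ V ℝ)), -(u / f (0, 1)),
    fun v => ?_⟩
  by_cases hv : F v = ⊤
  · rw [hv]; exact le_top
  have hrv : ((F v).toReal : EReal) = F v := EReal.coe_toReal hv (hbot v)
  have h2 := h1 (v, (F v).toReal) hrv.ge
  rw [hsplit] at h2
  rw [← hrv, EReal.coe_le_coe_iff]
  simp only [neg_apply, smul_apply,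
    ContinuousLinearMap.comp_apply, ContinuousLinearMap.inl_apply, smul_eq_mul]
  rw [← sub_nonneg]
  have : (F v).toReal - (-((f (0, 1))⁻¹ * f (v, 0)) - -(u / f (0, 1)))
      = (f (v, 0) + (F v).toReal * f (0, 1) - u) / f (0, 1) := by
    field_simp
    ring
  rw [this]
  exact div_nonneg (by linarith) hα.le

end Functionals

/-! ### The conjugate energy -/

namespace BoundedOpenSet

variable {d : ℕ} {Ω : BoundedOpenSet d} {U : Ω.L1 → EReal}

theorem IsInternalEnergy.nonneg (hU : IsInternalEnergy U) {ρ : Ω.L1} (hρ : U ρ ≠ ⊤) : 0 ≤ ρ := by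
  rw [← Lp.coeFn_nonneg]
  have h : Ω.leb {x | ρ x < 0} = 0 := by
    by_contra h
    exact hρ (hU.eq_top_of_neg ρ h)
  filter_upwards [measure_eq_zero_iff_ae_notMem.1 h] with x hx
  simpa using hx

theorem integrable_LInf_mul (φ : Ω.LInf) (ρ : Ω.L1) : Integrable (fun x => φ x * ρ x) Ω.leb :=
  (Lp.memLp φ).integrable_mul (Lp.memLp ρ)

theorem coeFn_toLInf (φ : C(Ω.Cl, ℝ)) : Ω.toLInf φ =ᵐ[Ω.leb] φ :=
  ContinuousMap.coeFn_toLp Ω.leb φ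

theorem integral_toLInf_mul (φ : C(Ω.Cl, ℝ)) (ρ : Ω.L1) :
    ∫ x, Ω.toLInf φ x * ρ x ∂Ω.leb = ∫ x, φ x * ρ x ∂Ω.leb := by
  refine integral_congr_ae ?_
  filter_upwards [coeFn_toLInf φ] with x hx
  rw [hx]

theorem toLInf_mono {φ φ' : C(Ω.Cl, ℝ)} (h : ∀ x, φ x ≤ φ' x) : Ω.toLInf φ ≤ Ω.toLInf φ' := by
  rw [← Lp.coeFn_le]
  filter_upwards [coeFn_toLInf φ, coeFn_toLInf φ'] with x h1 h2
  rw [h1, h2]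
  exact h x

/-- Densities of infinite energy contribute `-∞` and may be dropped. The remaining terms are real,
so they can be studied one at a time. -/
theorem conjugate_eq_iSup (hU : IsInternalEnergy U) (φ : Ω.LInf) :
    conjugate U φ = ⨆ ρ : {ρ : Ω.L1 // U ρ ≠ ⊤},
      ((∫ x, φ x * ρ.1 x ∂Ω.leb - (U ρ.1).toReal : ℝ) : EReal) := by
  have e : ∀ ρ : Ω.L1, U ρ ≠ ⊤ → ((∫ x, φ x * ρ x ∂Ω.leb - (U ρ).toReal : ℝ) : EReal) =
      ((∫ x, φ x * ρ x ∂Ω.leb : ℝ) : EReal) - U ρ := by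
    intro ρ hρ
    rw [EReal.coe_sub, EReal.coe_toReal hρ (hU.proper.1 ρ)]
  refine le_antisymm (iSup_le fun ρ => ?_) (iSup_le fun ρ => ?_)
  · by_cases hρ : U ρ = ⊤
    · rw [hρ, EReal.sub_top]
      exact bot_le
    · rw [← e ρ hρ]
      exact le_iSup (fun ρ : {ρ : Ω.L1 // U ρ ≠ ⊤} =>
        ((∫ x, φ x * ρ.1 x ∂Ω.leb - (U ρ.1).toReal : ℝ) : EReal)) ⟨ρ, hρ⟩
  · rw [e ρ.1 ρ.2]
    exact le_iSup (fun ρ : Ω.L1 => ((∫ x, φ x * ρ x ∂Ω.leb : ℝ) : EReal) - U ρ) ρ.1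

/-- Only nonnegative densities compete in the supremum. -/
theorem conjugate_mono (hU : IsInternalEnergy U) : Monotone (conjugate U) := by
  intro φ φ' h
  rw [conjugate_eq_iSup hU, conjugate_eq_iSup hU]
  refine iSup_mono fun ρ => EReal.coe_le_coe_iff.2 (sub_le_sub_right ?_ _)
  refine integral_mono_ae (integrable_LInf_mul φ _) (integrable_LInf_mul φ' _) ?_
  filter_upwards [(Lp.coeFn_le _ _).2 h, (Lp.coeFn_nonneg _).2 (hU.nonneg ρ.2)] with x h1 h2
  exact mul_le_mul_of_nonneg_right h1 h2

theorem conjugate_ne_bot (hU : IsInternalEnergy U) (φ : Ω.LInf) : conjugate U φ ≠ ⊥ := by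
  obtain ⟨ρ, hρ⟩ := hU.proper.2
  rw [conjugate_eq_iSup hU]
  exact ne_bot_of_le_ne_bot (EReal.coe_ne_bot _) (le_iSup (fun ρ : {ρ : Ω.L1 // U ρ ≠ ⊤} =>
        ((∫ x, φ x * ρ.1 x ∂Ω.leb - (U ρ.1).toReal : ℝ) : EReal)) ⟨ρ, hρ⟩)

theorem exists_conjugate_const_ne_top (hU : IsInternalEnergy U) :
    ∃ c : ℝ, conjugate U (Ω.toLInf (ContinuousMap.const _ c)) ≠ ⊤ := by
  obtain ⟨g, C, h⟩ := exists_affine_le_of_lsc hU.proper hU.convex hU.lsc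
  -- For `ρ ≥ 0` the integral of `-‖g‖ * ρ` is `-‖g‖ * ‖ρ‖ ≤ g ρ ≤ U ρ + C`, so the conjugate is at
  -- most `C` at this constant.
  refine ⟨-‖g‖, ne_top_of_le_ne_top (EReal.coe_ne_top C) ?_⟩
  rw [conjugate_eq_iSup hU]
  refine iSup_le fun ρ => EReal.coe_le_coe_iff.2 ?_
  have h1 := h ρ.1
  rw [← EReal.coe_toReal ρ.2 (hU.proper.1 _), EReal.coe_le_coe_iff] at h1
  have h2 : -(‖g‖ * ‖ρ.1‖) ≤ g ρ.1 := (abs_le.1 (g.le_opNorm ρ.1)).1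
  have h3 : ‖ρ.1‖ = ∫ x, ρ.1 x ∂Ω.leb := by
    rw [L1.norm_eq_integral_norm]
    refine integral_congr_ae ?_
    filter_upwards [(Lp.coeFn_nonneg _).2 (hU.nonneg ρ.2)] with x hx
    exact Real.norm_of_nonneg hx
  rw [integral_toLInf_mul]
  simp only [ContinuousMap.const_apply]
  rw [integral_const_mul, ← h3]
  linarith

theorem coe_sub_conjugate_ne_top (hU : IsInternalEnergy U) (a : ℝ) (φ : Ω.LInf) :
    (a : EReal) - conjugate U φ ≠ ⊤ := by
  have := conjugate_ne_bot hU φ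
  generalize conjugate U φ = s at *
  induction s <;> simp_all [← EReal.coe_sub]

theorem coe_sub_conjugate_ne_bot {a : ℝ} {φ : Ω.LInf} (h : conjugate U φ ≠ ⊤) :
    (a : EReal) - conjugate U φ ≠ ⊥ := by
  generalize conjugate U φ = s at *
  induction s <;> simp_all [← EReal.coe_sub]

/-! ### Properness, concavity, semicontinuity and common supremum of `J` and `I` -/

theorem properConcave_dualJ (τ : ℝ) (hU : IsInternalEnergy U) (μ : Ω.L1) :
    ProperConcave (dualJ τ U μ) := by
  refine ⟨fun φ => coe_sub_conjugate_ne_top hU _ _, ?_⟩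
  obtain ⟨c, hc⟩ := exists_conjugate_const_ne_top hU
  exact ⟨ContinuousMap.const _ c, coe_sub_conjugate_ne_bot hc⟩

theorem properConcave_dualI {τ : ℝ} (hτ : 0 < τ) (hU : IsInternalEnergy U) (μ : Ω.L1) :
    ProperConcave (dualI τ U μ) := by
  refine ⟨fun φ => coe_sub_conjugate_ne_top hU _ _, ?_⟩
  obtain ⟨c, hc⟩ := exists_conjugate_const_ne_top hU
  exact ⟨ContinuousMap.const _ c, coe_sub_conjugate_ne_bot (ne_top_of_le_ne_top hc
    (conjugate_mono hU (toLInf_mono fun y => forwardTransform_const_le hτ c y)))⟩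

theorem dualJ_eq_iInf (τ : ℝ) (hU : IsInternalEnergy U) (μ : Ω.L1) :
    dualJ τ U μ = fun φ => ⨅ ρ : {ρ : Ω.L1 // U ρ ≠ ⊤},
      ((∫ x, backwardTransform τ φ x * μ x ∂Ω.leb -
        (∫ x, φ x * ρ.1 x ∂Ω.leb - (U ρ.1).toReal) : ℝ) : EReal) := by
  ext1 φ
  rw [dualJ, conjugate_eq_iSup hU, EReal.coe_sub_iSup]
  simp only [integral_toLInf_mul, EReal.coe_sub]

theorem dualI_eq_iInf (τ : ℝ) (hU : IsInternalEnergy U) (μ : Ω.L1) :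
    dualI τ U μ = fun ψ => ⨅ ρ : {ρ : Ω.L1 // U ρ ≠ ⊤},
      ((∫ x, ψ x * μ x ∂Ω.leb -
        (∫ x, forwardTransform τ ψ x * ρ.1 x ∂Ω.leb - (U ρ.1).toReal) : ℝ) : EReal) := by
  ext1 ψ
  rw [dualI, conjugate_eq_iSup hU, EReal.coe_sub_iSup]
  simp only [integral_toLInf_mul, EReal.coe_sub]

theorem continuous_integral_mul (ρ : Ω.L1) :
    Continuous fun u : C(Ω.Cl, ℝ) => ∫ x, u x * ρ x ∂Ω.leb :=
  (isBoundedLinearMap_integral_mul ρ).continuous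

theorem integral_combination (ρ : Ω.L1) (a b : ℝ) (u v : C(Ω.Cl, ℝ)) :
    ∫ x, (a * u x + b * v x) * ρ x ∂Ω.leb =
      a * ∫ x, u x * ρ x ∂Ω.leb + b * ∫ x, v x * ρ x ∂Ω.leb := by
  have h := isBoundedLinearMap_integral_mul ρ
  have h1 := h.map_add (a • u) (b • v)
  rw [h.map_smul, h.map_smul] at h1
  simpa using h1

theorem integral_mul_mono {ρ : Ω.L1} (hρ : 0 ≤ ρ) {u v : Ω.Cl → ℝ} (h : ∀ x, u x ≤ v x)
    (hu : Integrable (fun x => u x * ρ x) Ω.leb) (hv : Integrable (fun x => v x * ρ x) Ω.leb) :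
    ∫ x, u x * ρ x ∂Ω.leb ≤ ∫ x, v x * ρ x ∂Ω.leb := by
  refine integral_mono_ae hu hv ?_
  filter_upwards [(Lp.coeFn_nonneg _).2 hρ] with x hx
  exact mul_le_mul_of_nonneg_right (h x) hx

theorem integrable_combination (ρ : Ω.L1) (a b : ℝ) (u v : C(Ω.Cl, ℝ)) :
    Integrable (fun x => (a * u x + b * v x) * ρ x) Ω.leb := by
  simpa using integrable_continuous_mul (a • u + b • v) ρ

theorem concaveOn_dualJ_slice (τ : ℝ) {μ : Ω.L1} (hμ : 0 ≤ μ) (ρ : Ω.L1) (r : ℝ) :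
    ConcaveOn ℝ Set.univ fun φ : C(Ω.Cl, ℝ) =>
      ∫ x, backwardTransform τ φ x * μ x ∂Ω.leb - (∫ x, φ x * ρ x ∂Ω.leb - r) := by
  refine ⟨convex_univ, fun φ _ φ' _ a b ha hb hab => ?_⟩
  have h1 := integral_mul_mono hμ (backwardTransform_concave τ φ φ' ha hb hab)
    (integrable_combination _ _ _ _ _) (integrable_continuous_mul _ _)
  rw [integral_combination] at h1
  have h2 := integral_combination ρ a b φ φ'
  simp only [ContinuousMap.add_apply, ContinuousMap.smul_apply, smul_eq_mul]
  rw [h2]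
  have h3 : r = a * r + b * r := by rw [← add_mul, hab, one_mul]
  linarith

/-- Here the sign of `ρ` carries pointwise convexity of `ψ^c̄` to the integral, as the sign of `μ`
carries concavity of `φᶜ` in the slices of `J`. -/
theorem concaveOn_dualI_slice (τ : ℝ) (μ : Ω.L1) {ρ : Ω.L1} (hρ : 0 ≤ ρ) (r : ℝ) :
    ConcaveOn ℝ Set.univ fun ψ : C(Ω.Cl, ℝ) =>
      ∫ x, ψ x * μ x ∂Ω.leb - (∫ x, forwardTransform τ ψ x * ρ x ∂Ω.leb - r) := by
  refine ⟨convex_univ, fun ψ _ ψ' _ a b ha hb hab => ?_⟩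
  have h1 := integral_mul_mono hρ (forwardTransform_convex τ ψ ψ' ha hb hab)
    (integrable_continuous_mul _ _) (integrable_combination _ _ _ _ _)
  rw [integral_combination] at h1
  have h2 := integral_combination μ a b ψ ψ'
  simp only [ContinuousMap.add_apply, ContinuousMap.smul_apply, smul_eq_mul]
  rw [h2]
  have h3 : r = a * r + b * r := by rw [← add_mul, hab, one_mul]
  linarith

theorem concaveFunctional_dualJ (τ : ℝ) (hU : IsInternalEnergy U) {μ : Ω.L1} (hμ : 0 ≤ μ) :
    ConcaveFunctional (dualJ τ U μ) := by
  rw [dualJ_eq_iInf τ hU]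
  exact concaveFunctional_iInf fun ρ : {ρ : Ω.L1 // U ρ ≠ ⊤} => concaveOn_dualJ_slice τ hμ _ _

theorem concaveFunctional_dualI (τ : ℝ) (hU : IsInternalEnergy U) (μ : Ω.L1) :
    ConcaveFunctional (dualI τ U μ) := by
  rw [dualI_eq_iInf τ hU]
  exact concaveFunctional_iInf fun ρ : {ρ : Ω.L1 // U ρ ≠ ⊤} =>
    concaveOn_dualI_slice τ μ (hU.nonneg ρ.2) _

theorem weaklyUpperSemicontinuous_dualJ (τ : ℝ) (hU : IsInternalEnergy U) {μ : Ω.L1}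
    (hμ : 0 ≤ μ) : WeaklyUpperSemicontinuous (dualJ τ U μ) := by
  rw [dualJ_eq_iInf τ hU]
  exact weaklyUpperSemicontinuous_iInf
    (fun ρ : {ρ : Ω.L1 // U ρ ≠ ⊤} => concaveOn_dualJ_slice τ hμ _ _)
    fun ρ => ((continuous_integral_mul μ).comp (lipschitzWith_backwardTransform τ).continuous).sub
      ((continuous_integral_mul ρ.1).sub continuous_const)

theorem weaklyUpperSemicontinuous_dualI (τ : ℝ) (hU : IsInternalEnergy U) (μ : Ω.L1) :
    WeaklyUpperSemicontinuous (dualI τ U μ) := by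
  rw [dualI_eq_iInf τ hU]
  exact weaklyUpperSemicontinuous_iInf
    (fun ρ : {ρ : Ω.L1 // U ρ ≠ ⊤} => concaveOn_dualI_slice τ μ (hU.nonneg ρ.2) _)
    fun ρ => (continuous_integral_mul μ).sub
      (((continuous_integral_mul ρ.1).comp (continuous_forwardTransform τ)).sub continuous_const)

/-- Transforming a competitor never lowers the value: `J φ ≤ I (φᶜ)` because `φ^{c c̄} ≤ φ` and `U*`
is monotone, and `I ψ ≤ J (ψ^c̄)` because `ψ ≤ ψ^{c̄ c}` and `μ ≥ 0`. -/
theorem iSup_dualJ_eq_iSup_dualI (τ : ℝ) (hU : IsInternalEnergy U) {μ : Ω.L1} (hμ : 0 ≤ μ) :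
    (⨆ φ : C(Ω.Cl, ℝ), dualJ τ U μ φ) = ⨆ ψ : C(Ω.Cl, ℝ), dualI τ U μ ψ := by
  refine le_antisymm (iSup_le fun φ => ?_) (iSup_le fun ψ => ?_)
  · refine le_trans ?_ (le_iSup (dualI τ U μ) (backwardTransform τ φ))
    exact EReal.sub_le_sub le_rfl
      (conjugate_mono hU (toLInf_mono (forwardTransform_backwardTransform_le τ φ)))
  · refine le_trans ?_ (le_iSup (dualJ τ U μ) (forwardTransform τ ψ))
    exact EReal.sub_le_sub (EReal.coe_le_coe_iff.2 (integral_mul_mono hμ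
      (le_backwardTransform_forwardTransform τ ψ) (integrable_continuous_mul _ _)
      (integrable_continuous_mul _ _))) le_rfl

end BoundedOpenSet

/-! ### Derivatives in one real variable -/

section Functionals

theorem hasDerivAt_toReal_coe_sub {A : ℝ → ℝ} {B : ℝ → EReal} {a b : ℝ}
    (hB : ∀ᶠ t in 𝓝 0, B t ≠ ⊥ ∧ B t ≠ ⊤) (hA : HasDerivAt A a 0)
    (hB' : HasDerivAt (fun t => (B t).toReal) b 0) :
    (∀ᶠ t in 𝓝 0, (A t : EReal) - B t ≠ ⊥ ∧ (A t : EReal) - B t ≠ ⊤) ∧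
      HasDerivAt (fun t => ((A t : EReal) - B t).toReal) (a - b) 0 := by
  have e : ∀ᶠ t in 𝓝 0, (A t : EReal) - B t = ((A t - (B t).toReal : ℝ) : EReal) := by
    filter_upwards [hB] with t ht
    rw [EReal.coe_sub, EReal.coe_toReal ht.2 ht.1]
  refine ⟨?_, (hA.sub hB').congr_of_eventuallyEq ?_⟩
  · filter_upwards [e] with t ht
    rw [ht]
    exact ⟨EReal.coe_ne_bot _, EReal.coe_ne_top _⟩
  · filter_upwards [e] with t ht
    rw [ht, EReal.toReal_coe, Pi.sub_apply]

/-- The minorant `g` already has the right slope. Each majorant `k s` works only on the side of `0`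
containing `s` and has a slightly wrong slope, so `s` is fixed first, with slope error below `ε /
2`, and then `t` tends to `0`. -/
theorem hasDerivAt_zero_of_sandwich {f g : ℝ → ℝ} {k : ℝ → ℝ → ℝ} {a : ℝ} {α : ℝ → ℝ}
    (hg : HasDerivAt g a 0) (hg0 : g 0 = f 0) (hgf : ∀ᶠ t in 𝓝 0, g t ≤ f t)
    (hk : ∀ s ≠ 0, HasDerivAt (k s) (α s) 0) (hk0 : ∀ s ≠ 0, k s 0 = f 0)
    (hfk : ∀ s ≠ 0, ∀ᶠ t in 𝓝 0, 0 ≤ t / s → f t ≤ k s t)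
    (hα : Tendsto α (𝓝[≠] 0) (𝓝 a)) : HasDerivAt f a 0 := by
  rw [hasDerivAt_iff_isLittleO_nhds_zero, Asymptotics.isLittleO_iff]
  intro ε hε
  have hε2 : 0 < ε / 2 := half_pos hε
  have hup : ∀ s ≠ 0, |α s - a| < ε / 2 →
      ∀ᶠ t in 𝓝 0, 0 ≤ t / s → f t - f 0 - t * a ≤ ε * |t| := by
    intro s hs hsa
    have h := hk s hs
    rw [hasDerivAt_iff_isLittleO_nhds_zero, Asymptotics.isLittleO_iff] at h
    filter_upwards [h hε2, hfk s hs] with t h1 h2 ht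
    have h3 := h2 ht
    simp only [zero_add, hk0 s hs, smul_eq_mul, Real.norm_eq_abs] at h1
    have h4 : |t * (α s - a)| ≤ ε / 2 * |t| := by
      rw [abs_mul, mul_comm]
      exact mul_le_mul_of_nonneg_right hsa.le (abs_nonneg t)
    have h5 := (abs_le.1 h4).2
    have h6 := (abs_le.1 h1).2
    rw [mul_sub] at h5
    linarith
  have hnear := Metric.tendsto_nhds.1 hα _ hε2
  have hpos : ∃ s > 0, |α s - a| < ε / 2 := by
    have h := (hnear.filter_mono (nhdsGT_le_nhdsNE 0)).and
      (self_mem_nhdsWithin (s := Set.Ioi 0) (a := (0 : ℝ)))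
    obtain ⟨s, h1, h2⟩ := h.exists
    exact ⟨s, h2, h1⟩
  have hneg : ∃ s < 0, |α s - a| < ε / 2 := by
    have h := (hnear.filter_mono (nhdsLT_le_nhdsNE 0)).and
      (self_mem_nhdsWithin (s := Set.Iio 0) (a := (0 : ℝ)))
    obtain ⟨s, h1, h2⟩ := h.exists
    exact ⟨s, h2, h1⟩
  obtain ⟨p, hp, hpa⟩ := hpos
  obtain ⟨n, hn, hna⟩ := hneg
  rw [hasDerivAt_iff_isLittleO_nhds_zero, Asymptotics.isLittleO_iff] at hg
  filter_upwards [hup p hp.ne' hpa, hup n hn.ne hna, hg hε, hgf] with t h1 h2 h3 h4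
  simp only [zero_add, hg0, smul_eq_mul, Real.norm_eq_abs] at h3 ⊢
  have h5 := (abs_le.1 h3).1
  refine abs_le.2 ⟨by linarith, ?_⟩
  rcases le_total 0 t with ht | ht
  · exact h1 (div_nonneg ht hp.le)
  · exact h2 (div_nonneg_of_nonpos ht hn.le)

end Functionals

/-! ### First variations of `J` and `I` -/

namespace BoundedOpenSet

variable {d : ℕ} {Ω : BoundedOpenSet d} {U : Ω.L1 → EReal}

theorem toLInf_add_smul (φ u : C(Ω.Cl, ℝ)) (t : ℝ) :
    Ω.toLInf (φ + t • u) = Ω.toLInf φ + t • Ω.toLInf u := by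
  simp only [toLInf, map_add, map_smul]

theorem IsFirstVariationConjugate.hasDerivAt {χ : Ω.LInf} {ρ : Ω.L1}
    (h : IsFirstVariationConjugate U χ ρ) (g : Ω.LInf) :
    HasDerivAt (fun t : ℝ => (conjugate U (χ + t • g)).toReal) (∫ x, g x * ρ x ∂Ω.leb) 0 :=
  (h.2 g).2

theorem hasFirstVariation_dualJ {τ : ℝ} (hτ : 0 < τ) {μ : Ω.L1} (hμ : 0 ≤ μ) {φ : C(Ω.Cl, ℝ)}
    {ρ : Ω.L1} (h : IsFirstVariationConjugate U (Ω.toLInf φ) ρ) :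
    HasFirstVariation (dualJ τ U μ) φ fun u =>
      (∫ y, u y ∂(pushforward (mapT τ φ) μ)) - ∫ y, u y * ρ y ∂Ω.leb := by
  have hT := aemeasurable_mapT hτ φ
  simp only [integral_pushforward hT hμ]
  refine ⟨(isBoundedLinearMap_integral_comp_mul hT μ).sub (isBoundedLinearMap_integral_mul ρ),
    fun u => ?_⟩
  have h1 := (h.2 (Ω.toLInf u)).1
  have h2 := h.hasDerivAt (Ω.toLInf u)
  rw [integral_toLInf_mul] at h2
  simp only [← toLInf_add_smul] at h1 h2
  exact hasDerivAt_toReal_coe_sub h1 (hasDerivAt_integral_backwardTransform hτ φ u μ) h2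

/-- Along the indicator of a measurable set, monotonicity of `U*` makes the right difference
quotients nonnegative, so `ρ` has nonnegative integral over every such set. -/
theorem nonneg_of_isFirstVariationConjugate (hU : IsInternalEnergy U) {χ : Ω.LInf} {ρ : Ω.L1}
    (h : IsFirstVariationConjugate U χ ρ) : 0 ≤ ρ := by
  rw [← Lp.coeFn_nonneg]
  refine ae_nonneg_of_forall_setIntegral_nonneg (integrable_L1 ρ) fun s hs _ => ?_
  set g : Ω.LInf := indicatorConstLp ⊤ hs (measure_ne_top _ s) (1 : ℝ)
  have hg : g =ᵐ[Ω.leb] s.indicator fun _ => (1 : ℝ) := indicatorConstLp_coeFn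
  have h1 := (h.2 g).1
  have h2 := h.hasDerivAt g
  have hint : ∫ x, g x * ρ x ∂Ω.leb = ∫ x in s, ρ x ∂Ω.leb := by
    rw [← integral_indicator hs]
    refine integral_congr_ae ?_
    filter_upwards [hg] with x hx
    rw [hx]
    by_cases hxs : x ∈ s <;> simp [hxs]
  rw [← hint]
  refine ge_of_tendsto h2.tendsto_slope_zero_right ?_
  filter_upwards [h1.filter_mono nhdsWithin_le_nhds, self_mem_nhdsWithin] with t ht htpos
  have htpos : 0 < t := htpos
  have h0 := h1.self_of_nhds
  refine smul_nonneg (inv_nonneg.2 htpos.le) (sub_nonneg.2 ?_)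
  rw [zero_add]
  refine EReal.toReal_le_toReal (conjugate_mono hU ?_) h0.1 ht.2
  rw [zero_smul, add_zero, ← Lp.coeFn_le]
  filter_upwards [Lp.coeFn_add χ (t • g), Lp.coeFn_smul t g, hg] with x e1 e2 e3
  rw [e1, Pi.add_apply, e2, Pi.smul_apply, e3]
  have : 0 ≤ t • s.indicator (fun _ => (1 : ℝ)) x :=
    smul_nonneg htpos.le (Set.indicator_nonneg (fun _ _ => zero_le_one) x)
  linarith

theorem hasDerivAt_integral_forwardTransform {τ : ℝ} (hτ : 0 < τ) (ψ u : C(Ω.Cl, ℝ))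
    (ρ : Ω.L1) :
    HasDerivAt (fun t : ℝ => ∫ y, forwardTransform τ (ψ + t • u) y * ρ y ∂Ω.leb)
      (∫ y, u (mapS τ ψ y) * ρ y ∂Ω.leb) 0 := by
  have h := (hasDerivAt_integral_backwardTransform hτ (-ψ) (-u) ρ).neg
  rw [← mapS_eq_mapT_neg] at h
  simp only [ContinuousMap.neg_apply, neg_mul, integral_neg, neg_neg] at h
  refine h.congr_of_eventuallyEq (Eventually.of_forall fun t => ?_)
  simp only [forwardTransform_eq_neg, ContinuousMap.neg_apply, neg_mul, integral_neg, neg_add,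
    smul_neg, Pi.neg_apply]

/-- The difference quotient in `t = s` of `t ↦ (ψ + t u)^c̄`. -/
def forwardQuotient (τ : ℝ) (ψ u : C(Ω.Cl, ℝ)) (s : ℝ) : C(Ω.Cl, ℝ) :=
  s⁻¹ • (forwardTransform τ (ψ + s • u) - forwardTransform τ ψ)

/-- The function `t ↦ (ψ + t u)^c̄(y)` is convex, hence below its chord between `0` and `s`. Only `t
/ s` enters, so both signs of `s` are covered. -/
theorem forwardTransform_le_quotient {τ : ℝ} (ψ u : C(Ω.Cl, ℝ)) {s t : ℝ} (hs : s ≠ 0)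
    (h0 : 0 ≤ t / s) (h1 : t / s ≤ 1) (y : Ω.Cl) :
    forwardTransform τ (ψ + t • u) y ≤
      (forwardTransform τ ψ + t • forwardQuotient τ ψ u s) y := by
  have h := forwardTransform_convex τ (ψ + s • u) ψ h0 (sub_nonneg.2 h1) (by ring) y
  have e : (t / s) • (ψ + s • u) + (1 - t / s) • ψ = ψ + t • u := by
    rw [smul_add, smul_smul, div_mul_cancel₀ t hs, sub_smul, one_smul]
    abel
  rw [e] at h
  simp only [forwardQuotient, ContinuousMap.add_apply, ContinuousMap.smul_apply,
    ContinuousMap.sub_apply, smul_eq_mul]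
  rw [div_eq_mul_inv] at h
  linarith

theorem tendsto_integral_forwardQuotient {τ : ℝ} (hτ : 0 < τ) (ψ u : C(Ω.Cl, ℝ)) (ρ : Ω.L1) :
    Tendsto (fun s => ∫ y, forwardQuotient τ ψ u s y * ρ y ∂Ω.leb) (𝓝[≠] 0)
      (𝓝 (∫ y, u (mapS τ ψ y) * ρ y ∂Ω.leb)) := by
  refine (hasDerivAt_integral_forwardTransform hτ ψ u ρ).tendsto_slope_zero.congr fun s => ?_
  have h := isBoundedLinearMap_integral_mul ρ
  have h1 := h.map_smul s⁻¹ (forwardTransform τ (ψ + s • u) - forwardTransform τ ψ)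
  rw [h.map_sub] at h1
  rw [zero_add, zero_smul, add_zero]
  exact h1.symm

/-- Monotonicity of `U*` transfers pointwise bounds on `(ψ + t u)^c̄` by lines through `ψ^c̄`, and
along lines the first variation is known. -/
theorem hasDerivAt_conjugate_forwardTransform {τ : ℝ} (hτ : 0 < τ) (hU : IsInternalEnergy U)
    {ψ : C(Ω.Cl, ℝ)} {ρ : Ω.L1}
    (h : IsFirstVariationConjugate U (Ω.toLInf (forwardTransform τ ψ)) ρ) (u : C(Ω.Cl, ℝ)) :
    (∀ᶠ t : ℝ in 𝓝 0, conjugate U (Ω.toLInf (forwardTransform τ (ψ + t • u))) ≠ ⊥ ∧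
      conjugate U (Ω.toLInf (forwardTransform τ (ψ + t • u))) ≠ ⊤) ∧
    HasDerivAt (fun t : ℝ => (conjugate U (Ω.toLInf (forwardTransform τ (ψ + t • u)))).toReal)
      (∫ y, u (mapS τ ψ y) * ρ y ∂Ω.leb) 0 := by
  have hup : ∀ s t : ℝ, s ≠ 0 → 0 ≤ t / s → t / s ≤ 1 →
      conjugate U (Ω.toLInf (forwardTransform τ (ψ + t • u))) ≤ conjugate U
        (Ω.toLInf (forwardTransform τ ψ) + t • Ω.toLInf (forwardQuotient τ ψ u s)) := by
    intro s t hs h0 h1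
    rw [← toLInf_add_smul]
    exact conjugate_mono hU (toLInf_mono (forwardTransform_le_quotient ψ u hs h0 h1))
  have hfinq := fun s => (h.2 (Ω.toLInf (forwardQuotient τ ψ u s))).1
  have hfin : ∀ᶠ t : ℝ in 𝓝 0, conjugate U (Ω.toLInf (forwardTransform τ (ψ + t • u))) ≠ ⊥ ∧
      conjugate U (Ω.toLInf (forwardTransform τ (ψ + t • u))) ≠ ⊤ := by
    -- The chords with `s = 1` and `s = -1` bound the transform on the two sides of `0` for `|t| <
    -- 1`.
    filter_upwards [hfinq 1, hfinq (-1), Metric.ball_mem_nhds (0 : ℝ) one_pos] with t h1 h2 h3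
    refine ⟨conjugate_ne_bot hU _, ?_⟩
    rw [Metric.mem_ball, dist_zero_right, Real.norm_eq_abs, abs_lt] at h3
    rcases le_total 0 t with ht | ht
    · exact ne_top_of_le_ne_top h1.2 (hup 1 t one_ne_zero (by linarith) (by linarith))
    · exact ne_top_of_le_ne_top h2.2 (hup (-1) t (by norm_num) (by linarith) (by linarith))
  have hS := aemeasurable_mapS hτ ψ
  -- The direction `u ∘ S_ψ` may be discontinuous; this is where differentiability of `U*` on all of
  -- `L^∞` matters.
  have hmem : MemLp (fun y => u (mapS τ ψ y)) ⊤ Ω.leb :=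
    memLp_top_of_bound (u.continuous.measurable.comp_aemeasurable hS).aestronglyMeasurable ‖u‖
      (Eventually.of_forall fun _ => u.norm_coe_le_norm _)
  have h1 := (h.2 (hmem.toLp _)).1
  have h2 := h.hasDerivAt (hmem.toLp _)
  have hint : ∫ y, hmem.toLp _ y * ρ y ∂Ω.leb = ∫ y, u (mapS τ ψ y) * ρ y ∂Ω.leb := by
    refine integral_congr_ae ?_
    filter_upwards [hmem.coeFn_toLp] with y hy
    rw [hy]
  rw [hint] at h2
  -- The supremum for `ψ + t u` is tested at the old maximizer `S_ψ(y)`.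
  have hlow : ∀ t : ℝ, Ω.toLInf (forwardTransform τ ψ) + t • hmem.toLp _ ≤
      Ω.toLInf (forwardTransform τ (ψ + t • u)) := by
    intro t
    rw [← Lp.coeFn_le]
    filter_upwards [Lp.coeFn_add (Ω.toLInf (forwardTransform τ ψ)) (t • hmem.toLp _),
      Lp.coeFn_smul t (hmem.toLp _), hmem.coeFn_toLp, coeFn_toLInf (forwardTransform τ ψ),
      coeFn_toLInf (forwardTransform τ (ψ + t • u))] with y e1 e2 e3 e4 e5
    rw [e1, Pi.add_apply, e2, Pi.smul_apply, e3, e4, e5, forwardTransform_eq_mapS τ ψ y]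
    have := le_forwardTransform τ (ψ + t • u) (mapS τ ψ y) y
    simp only [ContinuousMap.add_apply, ContinuousMap.smul_apply, smul_eq_mul] at this ⊢
    linarith
  refine ⟨hfin, hasDerivAt_zero_of_sandwich
    (k := fun s t => (conjugate U (Ω.toLInf (forwardTransform τ ψ) +
      t • Ω.toLInf (forwardQuotient τ ψ u s))).toReal)
    (α := fun s => ∫ y, forwardQuotient τ ψ u s y * ρ y ∂Ω.leb) h2 ?_ ?_ (fun s _ => ?_)
    (fun s _ => ?_) (fun s hs => ?_) (tendsto_integral_forwardQuotient hτ ψ u ρ)⟩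
  · simp only [zero_smul, add_zero]
  · filter_upwards [h1, hfin] with t ht1 ht2
    exact EReal.toReal_le_toReal (conjugate_mono hU (hlow t)) ht1.1 ht2.2
  · have h3 := h.hasDerivAt (Ω.toLInf (forwardQuotient τ ψ u s))
    rwa [integral_toLInf_mul] at h3
  · simp only [zero_smul, add_zero]
  · have hts : ∀ᶠ t : ℝ in 𝓝 0, t / s < 1 := by
      have : Tendsto (fun t : ℝ => t / s) (𝓝 0) (𝓝 (0 / s)) := tendsto_id.div_const s
      rw [zero_div] at this
      exact this.eventually_lt_const one_pos
    filter_upwards [hfin, hfinq s, hts] with t ht1 ht2 ht3 ht0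
    exact EReal.toReal_le_toReal (hup s t hs ht0 ht3.le) ht1.1 ht2.2

theorem hasFirstVariation_dualI {τ : ℝ} (hτ : 0 < τ) (hU : IsInternalEnergy U) (μ : Ω.L1)
    {ψ : C(Ω.Cl, ℝ)} {ρ : Ω.L1}
    (h : IsFirstVariationConjugate U (Ω.toLInf (forwardTransform τ ψ)) ρ) :
    HasFirstVariation (dualI τ U μ) ψ fun u =>
      (∫ x, u x * μ x ∂Ω.leb) - ∫ x, u x ∂(pushforward (mapS τ ψ) ρ) := by
  have hS := aemeasurable_mapS hτ ψ
  simp only [integral_pushforward hS (nonneg_of_isFirstVariationConjugate hU h)]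
  refine ⟨(isBoundedLinearMap_integral_mul μ).sub (isBoundedLinearMap_integral_comp_mul hS ρ),
    fun u => ?_⟩
  obtain ⟨h1, h2⟩ := hasDerivAt_conjugate_forwardTransform hτ hU h u
  refine hasDerivAt_toReal_coe_sub h1 ?_ h2
  have hl := isBoundedLinearMap_integral_mul (Ω := Ω) μ
  have e : (fun t : ℝ => ∫ x, (ψ + t • u) x * μ x ∂Ω.leb) = fun t : ℝ =>
      ∫ x, ψ x * μ x ∂Ω.leb + t * ∫ x, u x * μ x ∂Ω.leb := by
    ext1 t
    rw [hl.map_add, hl.map_smul, smul_eq_mul]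
  rw [e]
  simpa using ((hasDerivAt_id (0 : ℝ)).mul_const (∫ x, u x * μ x ∂Ω.leb)).const_add
    (∫ x, ψ x * μ x ∂Ω.leb)

end BoundedOpenSet

end

theorem proposition2 {d : ℕ} (Ω : BoundedOpenSet d) (τ : ℝ) (hτ : 0 < τ)
    (U : Ω.L1 → EReal) (hU : BoundedOpenSet.IsInternalEnergy U)
    (μ : Ω.L1) (hμ : 0 ≤ μ) :
    (ProperConcave (BoundedOpenSet.dualJ τ U μ) ∧
      WeaklyUpperSemicontinuous (BoundedOpenSet.dualJ τ U μ) ∧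
      ConcaveFunctional (BoundedOpenSet.dualJ τ U μ)) ∧
    (ProperConcave (BoundedOpenSet.dualI τ U μ) ∧
      WeaklyUpperSemicontinuous (BoundedOpenSet.dualI τ U μ) ∧
      ConcaveFunctional (BoundedOpenSet.dualI τ U μ)) ∧
    (⨆ φ : C(Ω.Cl, ℝ), BoundedOpenSet.dualJ τ U μ φ) =
      (⨆ ψ : C(Ω.Cl, ℝ), BoundedOpenSet.dualI τ U μ ψ) ∧
    (∀ φ : C(Ω.Cl, ℝ), IsCConvex τ φ →
      (∀ᵐ x ∂Ω.leb, ∃! y, y ∈ argminSet τ φ x) ∧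
      AEMeasurable (mapT τ φ) Ω.leb ∧
      ∀ ρ : Ω.L1, BoundedOpenSet.IsFirstVariationConjugate U (Ω.toLInf φ) ρ →
        HasFirstVariation (BoundedOpenSet.dualJ τ U μ) φ fun u =>
          (∫ y, u y ∂(BoundedOpenSet.pushforward (mapT τ φ) μ)) - ∫ y, u y * ρ y ∂Ω.leb) ∧
    (∀ ψ : C(Ω.Cl, ℝ), IsCConcave τ ψ →
      (∀ᵐ y ∂Ω.leb, ∃! x, x ∈ argmaxSet τ ψ y) ∧
      AEMeasurable (mapS τ ψ) Ω.leb ∧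
      ∀ ρ : Ω.L1,
        BoundedOpenSet.IsFirstVariationConjugate U (Ω.toLInf (forwardTransform τ ψ)) ρ →
        0 ≤ ρ ∧
        HasFirstVariation (BoundedOpenSet.dualI τ U μ) ψ fun u =>
          (∫ x, u x * μ x ∂Ω.leb) - ∫ x, u x ∂(BoundedOpenSet.pushforward (mapS τ ψ) ρ)) := by
  exact ⟨⟨BoundedOpenSet.properConcave_dualJ τ hU μ,
      BoundedOpenSet.weaklyUpperSemicontinuous_dualJ τ hU hμ,
      BoundedOpenSet.concaveFunctional_dualJ τ hU hμ⟩,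
    ⟨BoundedOpenSet.properConcave_dualI hτ hU μ,
      BoundedOpenSet.weaklyUpperSemicontinuous_dualI τ hU μ,
      BoundedOpenSet.concaveFunctional_dualI τ hU μ⟩,
    BoundedOpenSet.iSup_dualJ_eq_iSup_dualI τ hU hμ,
    fun φ _ => ⟨BoundedOpenSet.ae_existsUnique_argmin hτ φ,
      BoundedOpenSet.aemeasurable_mapT hτ φ,
      fun _ h => BoundedOpenSet.hasFirstVariation_dualJ hτ hμ h⟩,
    fun ψ _ => ⟨BoundedOpenSet.ae_existsUnique_argmax hτ ψ,
      BoundedOpenSet.aemeasurable_mapS hτ ψ,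
      fun _ h => ⟨BoundedOpenSet.nonneg_of_isFirstVariationConjugate hU h,
        BoundedOpenSet.hasFirstVariation_dualI hτ hU μ h⟩⟩⟩
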